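/- Let $\rho$ be a continuous finite-dimensional complex representation of $SL(4,\mathbb{R})$ on $V$. For $A\in\mathfrak{sl}(4,\mathbb{R})$ let $d\rho(A)$ be the derivative of $\rho$ along the one-parameter group $\exp(tA)$ at $t=0$. A vector operator is a family $X_0,\dots,X_3$ of linear operators on $V$ with $[d\rho(A),X_\alpha]=\sum_\beta A^{\beta}{}_{\alpha}X_\beta$ for all $A\in\mathfrak{sl}(4,\mathbb{R})$; a vector operator with upper index satisfies $[d\rho(A),X^\alpha]=-\sum_\beta A^{\alpha}{}_{\beta}X^\beta$. For integers $\lambda_1\ge\lambda_2\ge\lambda_3\ge0$, an irreducible representation is labeled $[\lambda_1,\lambda_2,\lambda_3]$ if it has a highest weight vector of weight $(\lambda_1,\lambda_2,\lambda_3,0)$ (a nonzero vector fixed by the upper unitriangular matrices on which $\mathrm{diag}(t_1,t_2,t_3,t_4)$, $t_1t_2t_3t_4=1$, acts by $t_1^{\lambda_1}t_2^{\lambda_2}t_3^{\lambda_3}$). 1. The defining representation on $\mathbb{C}^4$ has label $[1,0,0]$. If $\rho$ is irreducible, then $\rho\otimes[1,0,0]$ contains neither $\rho$ nor its contragredient $g\mapsto\rho(g^{-1})^{T}$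 as a subrepresentation. In terms of labels, if $\rho$ is labeled $[\lambda_1,\lambda_2,\lambda_3]$, then $\rho\otimes[1,0,0]$ contains no finite-dimensional representation labeled $[\lambda_1,\lambda_2,\lambda_3]$ or $[\lambda_1,\lambda_1-\lambda_3,\lambda_1-\lambda_2]$. Now let $V=\bigoplus_i V_i$ be a decomposition into irreducible subrepresentations, with projections $P_i:V\to V_i$. 2. For every vector operator $X$, with lower or upper index, and every $\alpha$, the diagonal blocks $P_iX_\alpha|_{V_i}$ are zero. More generally $P_iX_\alpha|_{V_j}=0$ whenever $V_i$ is equivalent to $V_j$ or to the contragredient of $V_j$. 3. Consider a Dirac-type equation $iX^\alpha\partial_\alpha\Psi=\kappa\Psi$ for fields $\Psi:\mathbb{R}^4\to V$, with a diagonal mass operator $\kappa|_{V_i}=m_i\,\mathrm{id}$, $m_i\in\mathbb{C}$. Suppose that either the operator $iX^\alpha\partial_\alpha-\kappa$ commutes with the action $\Psi(x)\mapsto\rho(g)\Psi(g^{-1}(x-a))$ of the special affine group on smooth fields, or $X^\alpha=c^{\alpha\beta}Y_\beta$ for a vector operator $Y$ (with lower or upper index) and a constant real matrix $c$ (for instance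 the Minkowski metric). Then: (a) if, for some $i$, the equation restricted to $V_i$, that is $P_i\,(iX^\alpha\partial_\alpha\varphi-\kappa\varphi)=0$, has a differentiable solution $\varphi:\mathbb{R}^4\to V_i$ that is not identically zero, then $m_i=0$; hence $\kappa=0$ if this is the case for every $i$; (b) if the full equation has a plane wave solution $\Psi(x)=e^{-ip\cdot x}v$ with $p\in\mathbb{R}^4$, $v\ne0$, then at least one $m_i$ is zero; in particular $\kappa=0$ if all $m_i$ are equal. -/

import Mathlib

open scoped TensorProduct MatrixGroups ContDiff

noncomputable section

namespace SL4

/-- The strong continuity of a representation of `SL(4, ℝ)` on a normed space, where `SL(4, ℝ)`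
carries the topology induced from the space of real `4 × 4` matrices. -/
def IsContinuousRep {V : Type*} [NormedAddCommGroup V] [NormedSpace ℂ V]
    (ρ : Representation ℂ SL(4, ℝ) V) : Prop :=
  ∀ v : V, Continuous fun g : SL(4, ℝ) => ρ g v

/-- The defining (vector) representation of `SL(4, ℝ)` on `ℂ⁴`. -/
def vectorRep : Representation ℂ SL(4, ℝ) (Fin 4 → ℂ) where
  toFun g := Matrix.toLin' ((g : Matrix (Fin 4) (Fin 4) ℝ).map Complex.ofReal)
  map_one' := by
    ext i j
    simp [Matrix.map_one]
  map_mul' g h := by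
    have h1 : ((g * h : SL(4, ℝ)) : Matrix (Fin 4) (Fin 4) ℝ).map Complex.ofReal =
        (g : Matrix (Fin 4) (Fin 4) ℝ).map Complex.ofReal *
          (h : Matrix (Fin 4) (Fin 4) ℝ).map Complex.ofReal := by
      rw [Matrix.SpecialLinearGroup.coe_mul]
      exact Matrix.map_mul (f := Complex.ofRealHom)
    rw [h1, Matrix.toLin'_mul]
    rfl

/-- `σ` is contained in `τ`: it is equivalent to a subrepresentation of `τ`. -/
def Contains {V W : Type*} [AddCommGroup V] [Module ℂ V] [AddCommGroup W] [Module ℂ W]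
    (τ : Representation ℂ SL(4, ℝ) V) (σ : Representation ℂ SL(4, ℝ) W) : Prop :=
  ∃ f : Representation.IntertwiningMap σ τ, Function.Injective f

/-- `ρ` is the irreducible representation with label `[l₁, l₂, l₃]` (row lengths of the Young
diagram): it is irreducible and has a highest weight vector of weight `(l₁, l₂, l₃, 0)`. -/
structure HasLabel {V : Type*} [AddCommGroup V] [Module ℂ V]
    (ρ : Representation ℂ SL(4, ℝ) V) (l₁ l₂ l₃ : ℤ) : Prop where
  irreducible : ρ.IsIrreducible
  third_nonneg : 0 ≤ l₃
  third_le_second : l₃ ≤ l₂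
  second_le_first : l₂ ≤ l₁
  highestWeightVector : ∃ v : V, v ≠ 0 ∧
    (∀ g : SL(4, ℝ), (∀ i, g.1 i i = 1) → (∀ i j, j < i → g.1 i j = 0) → ρ g v = v) ∧
    (∀ g : SL(4, ℝ), (∀ i j, i ≠ j → g.1 i j = 0) →
      ρ g v = (((g.1 0 0) ^ l₁ * (g.1 1 1) ^ l₂ * (g.1 2 2) ^ l₃ : ℝ) : ℂ) • v)

/-- `B` is the operator representing the Lie algebra element `A`: it is the derivative at `0` of
`ρ` along the one-parameter subgroup `γ` of `SL(4, ℝ)` with velocity `A`, i.e. `γ t = exp (t A)`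
(in particular `A` is traceless). -/
def IsGenerator {V : Type*} [NormedAddCommGroup V] [NormedSpace ℂ V]
    (ρ : Representation ℂ SL(4, ℝ) V) (A : Matrix (Fin 4) (Fin 4) ℝ) (B : Module.End ℂ V) :
    Prop :=
  ∃ γ : ℝ → SL(4, ℝ),
    (∀ s t, γ (s + t) = γ s * γ t) ∧
    (∀ i j, HasDerivAt (fun t => (γ t).1 i j) (A i j) 0) ∧
    (∀ v, HasDerivAt (fun t => ρ (γ t) v) (B v) 0)

/-- An `SL(4, ℝ)` vector operator `X_α`: the commutators of the generators with `X_α` are those of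
a basis `e_α` of the vector representation, `[dρ(A), X_α] = ∑ β, A^β_α X_β` for `A ∈ sl(4, ℝ)`. -/
def IsVectorOperator {V : Type*} [NormedAddCommGroup V] [NormedSpace ℂ V]
    (ρ : Representation ℂ SL(4, ℝ) V) (X : Fin 4 → Module.End ℂ V) : Prop :=
  ∀ A B, IsGenerator ρ A B → ∀ α, B * X α - X α * B = ∑ β, (A β α : ℂ) • X β

/-- A vector operator `X^α` with upper index: `[dρ(A), X^α] = - ∑ β, A^α_β X^β`. -/
def IsContravariantVectorOperator {V : Type*} [NormedAddCommGroup V] [NormedSpace ℂ V]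
    (ρ : Representation ℂ SL(4, ℝ) V) (X : Fin 4 → Module.End ℂ V) : Prop :=
  ∀ A B, IsGenerator ρ A B → ∀ α, B * X α - X α * B = - ∑ β, (A α β : ℂ) • X β

/-- The component map onto the `i`-th summand of an internal direct sum. -/
def component {V ι : Type*} [AddCommGroup V] [Module ℂ V] [DecidableEq ι]
    {U : ι → Submodule ℂ V} (hU : DirectSum.IsInternal U) (i : ι) : V →ₗ[ℂ] U i :=
  DirectSum.component ℂ ι (fun k => U k) i ∘ₗ
    (LinearEquiv.ofBijective (DirectSum.coeLinearMap U) hU).symm.toLinearMap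

/-- The `(i, j)` block `U j → U i` of an operator on an internal direct sum. -/
def block {V ι : Type*} [AddCommGroup V] [Module ℂ V] [DecidableEq ι]
    {U : ι → Submodule ℂ V} (hU : DirectSum.IsInternal U) (T : Module.End ℂ V) (i j : ι) :
    U j →ₗ[ℂ] U i :=
  component hU i ∘ₗ T ∘ₗ (U j).subtype

/-- The Dirac-type operator `i X^α ∂_α - κ` applied to a field on `ℝ⁴`. -/
def diracOp {V : Type*} [NormedAddCommGroup V] [NormedSpace ℂ V]
    (X : Fin 4 → Module.End ℂ V) (κ : Module.End ℂ V) (Ψ : (Fin 4 → ℝ) → V) :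
    (Fin 4 → ℝ) → V :=
  fun x => Complex.I • ∑ α, X α (fderiv ℝ Ψ x (Pi.single α 1)) - κ (Ψ x)

/-- The action of the special affine group on fields:
`((g, a) · Ψ)(x) = ρ(g) Ψ(g⁻¹ (x - a))`. -/
def affineAct {V : Type*} [AddCommGroup V] [Module ℂ V]
    (ρ : Representation ℂ SL(4, ℝ) V) (g : SL(4, ℝ)) (a : Fin 4 → ℝ) (Ψ : (Fin 4 → ℝ) → V) :
    (Fin 4 → ℝ) → V :=
  fun x => ρ g (Ψ ((g⁻¹).1.mulVec (x - a)))

/-- The equation `i X^α ∂_α Ψ = κ Ψ` is affine invariant: its operator commutes with the action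
of the special affine group on smooth fields. -/
def IsAffineInvariant {V : Type*} [NormedAddCommGroup V] [NormedSpace ℂ V]
    (ρ : Representation ℂ SL(4, ℝ) V) (X : Fin 4 → Module.End ℂ V) (κ : Module.End ℂ V) : Prop :=
  ∀ (g : SL(4, ℝ)) (a : Fin 4 → ℝ) (Ψ : (Fin 4 → ℝ) → V), ContDiff ℝ ∞ Ψ →
    diracOp X κ (affineAct ρ g a Ψ) = affineAct ρ g a (diracOp X κ Ψ)

end SL4

end

/-!
The matrix `-1` lies in `SL(4, ℝ)` and is a central involution, so it acts by a sign on every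
irreducible representation. It acts by `-1` on `[1, 0, 0]`, hence on `ρ ⊗ [1, 0, 0]` by the sign
opposite to the one on `ρ` and on its contragredient. It also anticommutes with every vector
operator, which therefore has no block between components on which the sign is the same.

A plane wave with momentum `p` and amplitude `v` is a solution exactly when `M v = κ v` for
`M = ∑ p_α X^α`, and `M` is a real combination, with coefficients `q`, of an equivariant family.
Some `g ∈ SL(4, ℝ)` satisfies `g q = r q` with `r > 1`; hence `ρ(g)` rescales `M` by `r`, while it
commutes with `κ`. If `κ` were invertible, the finite spectrum of `κ⁻¹ M` would be stable under
multiplication by `r`, hence reduce to `0`, contradicting `κ⁻¹ M v = v`.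
-/

namespace SL4

section CentralInvolution

variable {K G V W : Type*} [Field K] [AddCommGroup V] [Module K V] [AddCommGroup W] [Module K W]

section Monoid

variable [Monoid G] {ρ : Representation K G V} {σ : Representation K G W} {z : G} {a b : K}

theorem nontrivial_of_isIrreducible (_ : ρ.IsIrreducible) : Nontrivial V :=
  IsSimpleModule.nontrivial (MonoidAlgebra K G) ρ.asModule

theorem exists_sign_of_isIrreducible (h : ρ.IsIrreducible) (hz : z ∈ Submonoid.center G)
    (hzz : z * z = 1) : ∃ ε : K, ε * ε = 1 ∧ ρ z = ε • 1 := by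
  have hinv (v : V) : ρ z (ρ z v) = v := by
    rw [← Module.End.mul_apply, ← map_mul, hzz, map_one, Module.End.one_apply]
  let f := Representation.IntertwiningMap.centralMul ρ z hz - .id ρ
  have hf (v : V) : f v = ρ z v - v := rfl
  rcases Representation.IsIrreducible.injective_or_eq_zero f with hinj | hzero
  · refine ⟨-1, by ring, LinearMap.ext fun v => ?_⟩
    have : f (ρ z v + v) = f 0 := by simp [hf, hinv, add_comm]
    simpa using eq_neg_of_add_eq_zero_left (hinj this)
  · refine ⟨1, one_mul 1, LinearMap.ext fun v => ?_⟩
    simpa [sub_eq_zero] using (hf v).symm.trans (DFunLike.congr_fun hzero v)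

theorem tprod_eq_smul_one (hρ : ρ z = a • 1) (hσ : σ z = b • 1) :
    ρ.tprod σ z = (a * b) • 1 := by
  rw [Representation.tprod_apply, hρ, hσ, TensorProduct.map_smul_left,
    TensorProduct.map_smul_right, smul_smul, TensorProduct.map_one]

theorem scalar_eq_of_injective_intertwiningMap [Nontrivial V] {f : ρ.IntertwiningMap σ}
    (hf : Function.Injective f) (hρ : ρ z = a • 1) (hσ : σ z = b • 1) : a = b := by
  obtain ⟨v, hv⟩ := exists_ne (0 : V)
  have hfv : f v ≠ 0 := fun h => hv (hf (h.trans (map_zero f).symm))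
  have h := f.isIntertwining _ _ z v
  rw [hρ, hσ] at h
  exact smul_left_injective K hfv (by simpa using h)

end Monoid

theorem dual_eq_smul_one [Group G] {ρ : Representation K G V} {z : G} {a : K}
    (hzz : z * z = 1) (hρ : ρ z = a • 1) : ρ.dual z = a • 1 := by
  ext f v
  simp [Representation.dual_apply, Module.Dual.transpose_apply, inv_eq_of_mul_eq_one_right hzz, hρ]

end CentralInvolution

instance : Fact (Even (Fintype.card (Fin 4))) := ⟨by decide⟩

theorem neg_one_mem_center {M : Type*} [Monoid M] [HasDistribNeg M] :
    (-1 : M) ∈ Submonoid.center M :=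
  Submonoid.mem_center_iff.2 fun g => by rw [mul_neg_one, neg_one_mul]

theorem vectorRep_apply (g : SL(4, ℝ)) (v : Fin 4 → ℂ) (i : Fin 4) :
    vectorRep g v i = ∑ j, (g.1 i j : ℂ) * v j := rfl

theorem vectorRep_neg_one : vectorRep (-1) = (-1 : ℂ) • 1 := by
  ext i j
  simp [vectorRep_apply, Matrix.one_apply, apply_ite Complex.ofReal, Pi.single_apply]

theorem vectorRep_transvection {i j : Fin 4} (h : i ≠ j) (v : Fin 4 → ℂ) :
    vectorRep (Matrix.SpecialLinearGroup.transvection h 1) v = v + v j • Pi.single i 1 := by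
  ext k
  simp [vectorRep_apply, Matrix.SpecialLinearGroup.transvection_coe, Matrix.one_apply,
    Matrix.single_apply, add_mul, Finset.sum_add_distrib, apply_ite Complex.ofReal, ite_mul,
    Pi.single_apply, ite_and, eq_comm]

theorem single_mem_of_apply_ne_zero (S : Subrepresentation vectorRep) {i j : Fin 4} (h : i ≠ j)
    {v : Fin 4 → ℂ} (hv : v ∈ S.toSubmodule) (hj : v j ≠ 0) :
    Pi.single i 1 ∈ S.toSubmodule := by
  have hmem := S.toSubmodule.sub_mem
    (S.apply_mem_toSubmodule (Matrix.SpecialLinearGroup.transvection h 1) hv) hv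
  rwa [vectorRep_transvection h, add_sub_cancel_left, S.toSubmodule.smul_mem_iff hj] at hmem

theorem vectorRep_isIrreducible : vectorRep.IsIrreducible := by
  have : Nontrivial (Subrepresentation vectorRep) :=
    ⟨⊥, ⊤, fun h => bot_ne_top (congrArg Subrepresentation.toSubmodule h)⟩
  refine ⟨fun S => or_iff_not_imp_left.2 fun hS => ?_⟩
  obtain ⟨v, hv, hv0⟩ := Submodule.exists_mem_ne_zero_of_ne_bot
    fun h => hS (Subrepresentation.toSubmodule_injective h)
  obtain ⟨j, hj⟩ := Function.ne_iff.1 hv0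
  have hne {i : Fin 4} (hi : i ≠ j) : Pi.single i 1 ∈ S.toSubmodule :=
    single_mem_of_apply_ne_zero S hi hv hj
  have hall (i : Fin 4) : Pi.single i (1 : ℂ) ∈ S.toSubmodule := by
    rcases eq_or_ne i j with rfl | hi
    · obtain ⟨k, hk⟩ := exists_ne i
      exact single_mem_of_apply_ne_zero S hk.symm (hne hk) (by simp)
    · exact hne hi
  refine Subrepresentation.toSubmodule_injective (top_unique fun w _ => ?_)
  rw [pi_eq_sum_univ' w]
  exact S.toSubmodule.sum_mem fun i _ => S.toSubmodule.smul_mem _ (hall i)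

theorem hasLabel_vectorRep : HasLabel vectorRep 1 0 0 where
  irreducible := vectorRep_isIrreducible
  third_nonneg := le_rfl
  third_le_second := le_rfl
  second_le_first := zero_le_one
  highestWeightVector := by
    have hsingle (g : SL(4, ℝ)) (i : Fin 4) : vectorRep g (Pi.single 0 1) i = g.1 i 0 := by
      simp [vectorRep_apply, Pi.single_apply]
    refine ⟨Pi.single 0 1, by simp, fun g hdiag hlower => ?_, fun g hoff => ?_⟩
    · ext i
      rw [hsingle]
      rcases eq_or_ne i 0 with rfl | hi
      · simp [hdiag]
      · simp [hlower i 0 (Fin.pos_of_ne_zero hi), hi]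
    · ext i
      rw [hsingle]
      rcases eq_or_ne i 0 with rfl | hi
      · simp
      · simp [hoff i 0 hi, hi]

section Labels

variable {V W : Type*} [AddCommGroup V] [Module ℂ V] [AddCommGroup W] [Module ℂ W]
  {ρ : Representation ℂ SL(4, ℝ) V} {σ : Representation ℂ SL(4, ℝ) W}

theorem exists_sign_neg_one (h : ρ.IsIrreducible) : ∃ ε : ℂ, ε * ε = 1 ∧ ρ (-1) = ε • 1 :=
  exists_sign_of_isIrreducible h neg_one_mem_center (by simp)

theorem not_contains_of_neg_one_eq [Nontrivial W] {ε : ℂ} (hε : ε ≠ 0) (hρ : ρ (-1) = ε • 1)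
    (hσ : σ (-1) = ε • 1) : ¬ Contains (ρ.tprod vectorRep) σ := by
  rintro ⟨f, hf⟩
  have h := scalar_eq_of_injective_intertwiningMap hf hσ (tprod_eq_smul_one hρ vectorRep_neg_one)
  exact hε (by linear_combination h / 2)

theorem not_contains_self (h : ρ.IsIrreducible) : ¬ Contains (ρ.tprod vectorRep) ρ := by
  obtain ⟨ε, hε, hρ⟩ := exists_sign_neg_one h
  have := nontrivial_of_isIrreducible h
  exact not_contains_of_neg_one_eq (left_ne_zero_of_mul_eq_one hε) hρ hρ

theorem not_contains_dual (h : ρ.IsIrreducible) : ¬ Contains (ρ.tprod vectorRep) ρ.dual := by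
  obtain ⟨ε, hε, hρ⟩ := exists_sign_neg_one h
  have := nontrivial_of_isIrreducible h
  exact not_contains_of_neg_one_eq (left_ne_zero_of_mul_eq_one hε) hρ
    (dual_eq_smul_one (by simp) hρ)

theorem HasLabel.rep_neg_one {l₁ l₂ l₃ : ℤ} (h : HasLabel ρ l₁ l₂ l₃) :
    ρ (-1) = ((-1 : ℂ) ^ (l₁ + l₂ + l₃)) • 1 := by
  obtain ⟨ε, -, hε⟩ := exists_sign_neg_one h.irreducible
  obtain ⟨v, hv, -, hdiag⟩ := h.highestWeightVector
  have hv' := hdiag (-1) fun i j hij => by simp [hij]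
  rw [hε] at hv' ⊢
  congr 1
  refine smul_left_injective ℂ hv (hv'.trans ?_)
  simp [zpow_add₀]

theorem not_contains_of_hasLabel {l₁ l₂ l₃ : ℤ} (hρ : HasLabel ρ l₁ l₂ l₃)
    (hσ : HasLabel σ l₁ l₂ l₃ ∨ HasLabel σ l₁ (l₁ - l₃) (l₁ - l₂)) :
    ¬ Contains (ρ.tprod vectorRep) σ := by
  have hparity : (-1 : ℂ) ^ (l₁ + (l₁ - l₃) + (l₁ - l₂)) = (-1) ^ (l₁ + l₂ + l₃) := by
    rw [show l₁ + (l₁ - l₃) + (l₁ - l₂) = (l₁ + l₂ + l₃) + 2 * (l₁ - l₂ - l₃) by ring,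
      zpow_add₀ (by norm_num), zpow_mul]
    norm_num
  have hσ' : σ (-1) = ((-1 : ℂ) ^ (l₁ + l₂ + l₃)) • 1 :=
    hσ.elim HasLabel.rep_neg_one fun h => hparity ▸ h.rep_neg_one
  have := nontrivial_of_isIrreducible (hσ.elim HasLabel.irreducible HasLabel.irreducible)
  exact not_contains_of_neg_one_eq (zpow_ne_zero _ (by norm_num)) hρ.rep_neg_one hσ'

end Labels

section Decomposition

variable {V W ι : Type*} [AddCommGroup V] [Module ℂ V] [AddCommGroup W] [Module ℂ W]
  [DecidableEq ι] {U : ι → Submodule ℂ V}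

theorem component_of_mem (hU : DirectSum.IsInternal U) {i : ι} {v : V} (hv : v ∈ U i) :
    component hU i v = ⟨v, hv⟩ :=
  hU.ofBijective_coeLinearMap_of_mem hv

theorem component_of_mem_ne (hU : DirectSum.IsInternal U) {i j : ι} (hij : i ≠ j) {v : V}
    (hv : v ∈ U i) : component hU j v = 0 :=
  hU.ofBijective_coeLinearMap_of_mem_ne hij hv

theorem linearMap_ext_of_isInternal (hU : DirectSum.IsInternal U) {f g : V →ₗ[ℂ] W}
    (h : ∀ i, ∀ v ∈ U i, f v = g v) : f = g :=
  LinearMap.eqLocus_eq_top.1 (top_unique (hU.submodule_iSup_eq_top ▸ iSup_le h))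

theorem eq_zero_of_component_eq_zero (hU : DirectSum.IsInternal U) {v : V}
    (h : ∀ i, component hU i v = 0) : v = 0 := by
  have : (LinearEquiv.ofBijective (DirectSum.coeLinearMap U) hU).symm v = 0 :=
    DirectSum.ext_component ℂ fun i => (h i).trans (map_zero _).symm
  simpa using this

section ScalarOnSummands

variable (hU : DirectSum.IsInternal U) {S : Module.End ℂ V} {m : ι → ℂ}
  (hS : ∀ i, ∀ v ∈ U i, S v = m i • v)

include hU hS

theorem component_apply_of_scalar (i : ι) (v : V) :
    component hU i (S v) = m i • component hU i v := by
  suffices component hU i ∘ₗ S = m i • component hU i from LinearMap.congr_fun this v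
  refine linearMap_ext_of_isInternal hU fun j v hv => ?_
  rw [LinearMap.comp_apply, LinearMap.smul_apply, hS j v hv, map_smul]
  rcases eq_or_ne j i with rfl | hij
  · rfl
  · rw [component_of_mem_ne hU hij hv, smul_zero, smul_zero]

theorem injective_of_scalar_ne_zero (hm : ∀ i, m i ≠ 0) : Function.Injective S := by
  refine (injective_iff_map_eq_zero S).2 fun v hv => eq_zero_of_component_eq_zero hU fun i => ?_
  have h := component_apply_of_scalar hU hS i v
  rw [hv, map_zero] at h
  exact (smul_eq_zero.1 h.symm).resolve_left (hm i)

theorem eq_zero_of_scalar_eq_zero (hm : ∀ i, m i = 0) : S = 0 :=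
  linearMap_ext_of_isInternal hU fun i v hv => by simp [hS i v hv, hm i]

theorem commute_of_scalar {T : Module.End ℂ V} (hT : ∀ i, ∀ v ∈ U i, T v ∈ U i) :
    Commute S T :=
  linearMap_ext_of_isInternal hU fun i v hv => by
    simp [hS i v hv, hS i _ (hT i v hv)]

theorem block_eq_zero_of_anticommute {T : Module.End ℂ V} (hST : S * T = -(T * S)) {i j : ι}
    (hij : m i + m j ≠ 0) : block hU T i j = 0 := by
  ext1 u
  have hanti : S (T u) = -T (S u) := LinearMap.congr_fun hST u
  have h := component_apply_of_scalar hU hS i (T u)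
  rw [hanti, hS j u u.2, map_smul, map_neg, map_smul, eq_comm, ← add_eq_zero_iff_eq_neg,
    ← add_smul] at h
  exact (smul_eq_zero.1 h).resolve_left hij

end ScalarOnSummands

theorem block_eq_zero_of_equiv_or_dual {ρ : Representation ℂ SL(4, ℝ) V}
    {U : ι → Subrepresentation ρ} (hU : DirectSum.IsInternal fun i => (U i).toSubmodule)
    (hirr : ∀ i, (U i).toRepresentation.IsIrreducible) {T : Module.End ℂ V}
    (hT : ρ (-1) * T = -(T * ρ (-1))) {i j : ι}
    (hij : Nonempty ((U i).toRepresentation.Equiv (U j).toRepresentation) ∨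
      Nonempty ((U i).toRepresentation.Equiv (U j).toRepresentation.dual)) :
    block hU T i j = 0 := by
  choose ε hε hUε using fun k => exists_sign_neg_one (hirr k)
  have hscalar (k : ι) (v : V) (hv : v ∈ U k) : ρ (-1) v = ε k • v :=
    congrArg Subtype.val (LinearMap.congr_fun (hUε k) ⟨v, hv⟩)
  have := nontrivial_of_isIrreducible (hirr i)
  have hεij : ε i = ε j := by
    rcases hij with ⟨⟨e⟩⟩ | ⟨⟨e⟩⟩
    · exact scalar_eq_of_injective_intertwiningMap (f := e.toIntertwiningMap)
        e.toLinearEquiv.injective (hUε i) (hUε j)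
    · exact scalar_eq_of_injective_intertwiningMap (f := e.toIntertwiningMap)
        e.toLinearEquiv.injective (hUε i) (dual_eq_smul_one (by simp) (hUε j))
  refine block_eq_zero_of_anticommute hU hscalar hT ?_
  rw [hεij, ← two_mul]
  exact mul_ne_zero two_ne_zero (left_ne_zero_of_mul_eq_one (hε j))

end Decomposition

section Rescaling

theorem eigenvalue_eq_zero_of_rescaling {K V : Type*} [Field K] [AddCommGroup V] [Module K V]
    [FiniteDimensional K V] {N T : Module.End K V} {r : K}
    (hr : Function.Injective fun n : ℕ => r ^ n) (hT : Function.Injective T)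
    (hNT : N * T = r • (T * N)) {μ : K} (hμ : N.HasEigenvalue μ) : μ = 0 := by
  have hstep {ν : K} (hν : N.HasEigenvalue ν) : N.HasEigenvalue (r * ν) := by
    obtain ⟨v, hv⟩ := hν.exists_hasEigenvector
    refine Module.End.hasEigenvalue_of_hasEigenvector (x := T v)
      ⟨Module.End.mem_eigenspace_iff.2 ?_, (map_ne_zero_iff T hT).2 hv.2⟩
    rw [← Module.End.mul_apply, hNT, LinearMap.smul_apply, Module.End.mul_apply, hv.apply_eq_smul,
      map_smul, smul_smul]
  have hpow (n : ℕ) : N.HasEigenvalue (r ^ n * μ) := by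
    induction n with
    | zero => simpa using hμ
    | succ n ih => simpa only [pow_succ', mul_assoc] using hstep ih
  by_contra hμ0
  exact Set.infinite_of_injective_forall_mem
    (fun a b hab => hr (mul_right_cancel₀ hμ0 hab)) hpow N.finite_hasEigenvalue

theorem eq_zero_of_rescaling {K V : Type*} [Field K] [AddCommGroup V] [Module K V]
    [FiniteDimensional K V] {κ M T : Module.End K V} {r : K}
    (hr : Function.Injective fun n : ℕ => r ^ n) (hT : Function.Injective T)
    (hMT : M * T = r • (T * M)) (hκT : Commute κ T) (hκ : Function.Injective κ) {v : V}
    (hv : M v = κ v) : v = 0 := by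
  obtain ⟨u, rfl⟩ := (LinearMap.isUnit_iff_ker_eq_bot κ).2 (LinearMap.ker_eq_bot.2 hκ)
  have hNT : (↑u⁻¹ * M) * T = r • (T * (↑u⁻¹ * M)) := by
    rw [mul_assoc, hMT, mul_smul_comm, ← mul_assoc, ← mul_assoc, hκT.units_inv_left.eq]
  have hNv : (↑u⁻¹ * M) v = (1 : K) • v := by
    rw [Module.End.mul_apply, hv, ← Module.End.mul_apply, Units.inv_mul, one_smul,
      Module.End.one_apply]
  by_contra hv0
  exact one_ne_zero (eigenvalue_eq_zero_of_rescaling hr hT hNT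
    (Module.End.hasEigenvalue_of_hasEigenvector ⟨Module.End.mem_eigenspace_iff.2 hNv, hv0⟩))

end Rescaling

section Transvections

open Matrix.SpecialLinearGroup

variable {n : Type*} [Fintype n] [DecidableEq n]

theorem coe_diag2n_eq_add_single {F : Type*} [Field F] {i j : n} (hij : i ≠ j) {a : F}
    (ha : a ≠ 0) :
    (diag2n hij a ha).1 = 1 + Matrix.single i i (a - 1) + Matrix.single j j (a⁻¹ - 1) := by
  ext k l
  simp only [diag2n_coe, Matrix.diagonal_apply, Matrix.add_apply, Matrix.one_apply,
    Matrix.single_apply]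
  grind

theorem diag2n_eq_mul_transvection {F : Type*} [Field F] {i j : n} (hij : i ≠ j) {a : F}
    (ha : a ≠ 0) :
    diag2n hij a ha =
      transvection hij a * transvection hij.symm (-a⁻¹) * transvection hij a *
        transvection hij (-1) * transvection hij.symm 1 * transvection hij (-1) := by
  refine Subtype.ext ?_
  rw [coe_diag2n_eq_add_single]
  simp only [Matrix.SpecialLinearGroup.coe_mul, transvection_coe, mul_add, add_mul,
    mul_one, one_mul, Matrix.single_mul_single_same,
    Matrix.single_mul_single_of_ne _ _ _ _ hij, Matrix.single_mul_single_of_ne _ _ _ _ hij.symm,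
    mul_neg, neg_mul, mul_inv_cancel₀ ha, inv_mul_cancel₀ ha, add_zero]
  ext k l
  simp only [Matrix.add_apply, Matrix.single_apply]
  grind

theorem transvection_induction [Nontrivial n] {F : Type*} [Field F]
    {P : Matrix.SpecialLinearGroup n F → Prop}
    (htransvection : ∀ (i j : n) (hij : i ≠ j) (a : F), P (transvection hij a))
    (hmul : ∀ g h, P g → P h → P (g * h)) (g : Matrix.SpecialLinearGroup n F) : P g := by
  refine diagonal_transvection_induction' P g (fun i j hij a ha => ?_) htransvection hmul
  rw [diag2n_eq_mul_transvection]
  refine hmul _ _ (hmul _ _ (hmul _ _ (hmul _ _ (hmul _ _ ?_ ?_) ?_) ?_) ?_) ?_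
  all_goals exact htransvection _ _ _ _

end Transvections

section OneParameterGroups

variable {A : Type*} [NormedRing A] [NormedAlgebra ℝ A] {f : ℝ → A}

theorem mul_integral_zero_eq_integral [CompleteSpace A] (hf : Continuous f)
    (hadd : ∀ s t, f (s + t) = f s * f t) (t a : ℝ) :
    f t * ∫ s in (0 : ℝ)..a, f s = ∫ s in t..(t + a), f s := by
  calc f t * ∫ s in (0 : ℝ)..a, f s = ∫ s in (0 : ℝ)..a, f t * f s :=
        ((ContinuousLinearMap.mul ℝ A (f t)).intervalIntegral_comp_comm
          (hf.intervalIntegrable 0 a)).symm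
    _ = ∫ s in (0 : ℝ)..a, f (t + s) := by simp only [hadd]
    _ = ∫ s in t..(t + a), f s := by
        rw [intervalIntegral.integral_comp_add_left f, add_zero]

-- The averages of `f` over short intervals `[0, a]` tend to `1`, so some integral `F a` is a unit;
-- then `f t = (F (t + a) - F t) (F a)⁻¹` is differentiable because `F` is.
theorem exists_hasDerivAt_of_continuous [CompleteSpace A] (hf : Continuous f) (h0 : f 0 = 1)
    (hadd : ∀ s t, f (s + t) = f s * f t) : ∃ B, HasDerivAt f B 0 := by
  let F : ℝ → A := fun a => ∫ s in (0 : ℝ)..a, f s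
  have hF (t : ℝ) : HasDerivAt F (f t) t :=
    intervalIntegral.integral_hasDerivAt_right (hf.intervalIntegrable _ _)
      hf.aestronglyMeasurable.stronglyMeasurableAtFilter hf.continuousAt
  have hslope := hasDerivAt_iff_tendsto_slope_zero.1 (hF 0)
  simp only [zero_add, h0, F, intervalIntegral.integral_same, sub_zero] at hslope
  obtain ⟨a, u, hu⟩ := (hslope.eventually (Units.isOpen.mem_nhds isUnit_one)).exists
  have hfF (t : ℝ) : f t * u = a⁻¹ • (F (t + a) - F t) := by
    rw [hu, mul_smul_comm, mul_integral_zero_eq_integral hf hadd,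
      intervalIntegral.integral_interval_sub_left (hf.intervalIntegrable _ _)
        (hf.intervalIntegrable _ _)]
  have hf' : f = fun t => (a⁻¹ • (F (t + a) - F t)) * (↑u⁻¹ : A) := by
    ext t
    rw [← hfF, Units.mul_inv_cancel_right]
  rw [hf']
  exact ⟨_, ((((hF (0 + a)).comp_add_const 0 a).sub (hF 0)).const_smul a⁻¹).mul_const _⟩

theorem hasDerivAt_of_hasDerivAt_zero (hadd : ∀ s t, f (s + t) = f s * f t) {B : A}
    (hB : HasDerivAt f B 0) (t : ℝ) : HasDerivAt f (B * f t) t := by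
  have hshift : HasDerivAt (fun s => f (s - t)) B t :=
    HasDerivAt.comp_sub_const t t (by rwa [sub_self])
  simpa only [← hadd, sub_add_cancel] using hshift.mul_const (f t)

theorem mul_eq_add_smul_mul_of_commutator (h0 : f 0 = 1) {B X N : A}
    (hf : ∀ t, HasDerivAt f (B * f t) t) (hX : B * X - X * B = N) (hN : Commute B N) (t : ℝ) :
    f t * X = (X + t • N) * f t := by
  have hright (t : ℝ) :
      HasDerivAt (fun t => (X + t • N) * f t) (B * ((X + t • N) * f t)) t := by
    refine ((((hasDerivAt_id t).smul_const N).const_add X).mul (hf t)).congr_deriv ?_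
    have hBX : B * X = X * B + N := by rw [← hX, add_sub_cancel]
    simp only [id, one_smul, ← mul_assoc, mul_add, add_mul, hBX, mul_smul_comm, smul_mul_assoc,
      hN.eq]
    abel
  have hleft (t : ℝ) : HasDerivAt (fun t => f t * X) (B * (f t * X)) t :=
    ((hf t).mul_const X).congr_deriv (mul_assoc _ _ _)
  have hLipschitz (_ : ℝ) :=
    (ContinuousLinearMap.mul ℝ A B).lipschitz.lipschitzOnWith (s := Set.univ)
  exact congrFun (ODE_solution_unique_univ (t₀ := 0) hLipschitz
    (fun t => ⟨hleft t, Set.mem_univ _⟩) (fun t => ⟨hright t, Set.mem_univ _⟩) (by simp [h0])) t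

end OneParameterGroups

section Stretch

variable {n : Type*} [Fintype n] [DecidableEq n]

theorem det_one_add_vecMulVec {R : Type*} [CommRing R] (u v : n → R) :
    (1 + Matrix.vecMulVec u v).det = 1 + v ⬝ᵥ u := by
  rw [Matrix.vecMulVec_eq Unit, Matrix.det_one_add_replicateCol_mul_replicateRow]

theorem exists_smul_eq_smul [Nontrivial n] (q : n → ℝ) :
    ∃ (g : Matrix.SpecialLinearGroup n ℝ) (r : ℝ), 1 < r ∧ g • q = r • q := by
  rcases eq_or_ne q 0 with rfl | hq
  · exact ⟨1, 2, one_lt_two, by simp⟩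
  let N : ℕ := Fintype.card n
  have hqq : q ⬝ᵥ q ≠ 0 := mt dotProduct_self_eq_zero.1 hq
  -- Halve every direction, then restore the determinant by stretching along `q`.
  let S : Matrix n n ℝ := 1 + Matrix.vecMulVec (((2 ^ N - 1) / (q ⬝ᵥ q)) • q) q
  have hdet : ((2 : ℝ)⁻¹ • S).det = 1 := by
    rw [Matrix.det_smul, det_one_add_vecMulVec, dotProduct_smul, smul_eq_mul,
      div_mul_cancel₀ _ hqq, add_sub_cancel, inv_pow, inv_mul_cancel₀ (by positivity)]
  have hSq : S.mulVec q = (2 ^ N : ℝ) • q := by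
    rw [Matrix.add_mulVec, Matrix.one_mulVec, Matrix.vecMulVec_mulVec, op_smul_eq_smul, smul_smul,
      mul_div_cancel₀ _ hqq, sub_smul, one_smul, add_sub_cancel]
  let g : Matrix.SpecialLinearGroup n ℝ := ⟨(2 : ℝ)⁻¹ • S, hdet⟩
  refine ⟨g, 2⁻¹ * 2 ^ N, ?_, ?_⟩
  · have hN : (2 : ℝ) ^ 1 < 2 ^ N := pow_lt_pow_right₀ one_lt_two Fintype.one_lt_card
    linarith
  · calc g • q = ((2 : ℝ)⁻¹ • S).mulVec q := rfl
      _ = (2⁻¹ * 2 ^ N : ℝ) • q := by rw [Matrix.smul_mulVec, hSq, smul_smul]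

end Stretch

section InverseTranspose

variable {n R : Type*} [Fintype n] [DecidableEq n] [CommRing R]

/-- The automorphism `g ↦ (g⁻¹)ᵀ`, which exchanges upper and lower indices. -/
def inverseTranspose : Matrix.SpecialLinearGroup n R →* Matrix.SpecialLinearGroup n R where
  toFun g := g⁻¹.transpose
  map_one' := Subtype.ext (by simp)
  map_mul' g h := Subtype.ext (by simp [Matrix.transpose_mul])

theorem coe_inverseTranspose (g : Matrix.SpecialLinearGroup n R) :
    (inverseTranspose g : Matrix n n R) = (g⁻¹ : Matrix.SpecialLinearGroup n R).1.transpose :=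
  rfl

theorem inverseTranspose_neg_one [Fact (Even (Fintype.card n))] :
    inverseTranspose (-1 : Matrix.SpecialLinearGroup n R) = -1 :=
  Subtype.ext (by simp [coe_inverseTranspose])

end InverseTranspose

section Equivariance

open Matrix.SpecialLinearGroup

variable {n V : Type*} [Fintype n] [AddCommGroup V] [Module ℂ V]

/-- The operator `∑ α, q^α X_α` attached to a vector `q` by a family of operators `X`
(the Feynman slash of `q`). -/
def slash (X : n → Module.End ℂ V) : (n → ℝ) →ₗ[ℝ] Module.End ℂ V :=
  Fintype.linearCombination ℝ X

theorem slash_eq_sum (X : n → Module.End ℂ V) (q : n → ℝ) :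
    slash X q = ∑ i, (q i : ℂ) • X i := by
  simp only [slash, Fintype.linearCombination_apply, Complex.coe_smul]

variable [DecidableEq n]

theorem slash_single (X : n → Module.End ℂ V) (i : n) : slash X (Pi.single i 1) = X i := by
  rw [slash, Fintype.linearCombination_apply_single, one_smul]

/-- The finite form of the defining property of a vector operator: the components of `X`
transform under conjugation by `ρ g` like the standard basis vectors under `g`. -/
def IsEquivariant (ρ : Representation ℂ (Matrix.SpecialLinearGroup n ℝ) V)
    (X : n → Module.End ℂ V) : Prop :=
  ∀ g q, ρ g * slash X q = slash X (g • q) * ρ g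

variable {ρ : Representation ℂ (Matrix.SpecialLinearGroup n ℝ) V} {X : n → Module.End ℂ V}

theorem isEquivariant_of_transvection [Nontrivial n]
    (h : ∀ (i j : n) (hij : i ≠ j) (a : ℝ) (q : n → ℝ),
      ρ (transvection hij a) * slash X q =
        slash X (transvection hij a • q) * ρ (transvection hij a)) :
    IsEquivariant ρ X := by
  intro g
  induction g using transvection_induction with
  | htransvection i j hij a => exact h i j hij a
  | hmul g h hg hh =>
    intro q
    rw [map_mul, mul_assoc, hh, ← mul_assoc, hg, mul_assoc, mul_smul]

theorem IsEquivariant.neg_one_mul_slash [Fact (Even (Fintype.card n))] (hX : IsEquivariant ρ X)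
    (q : n → ℝ) : ρ (-1) * slash X q = -(slash X q * ρ (-1)) := by
  have hq : (-1 : Matrix.SpecialLinearGroup n ℝ) • q = -q := by
    simp [Matrix.SpecialLinearGroup.smul_def]
  rw [hX, hq, map_neg, neg_mul]

theorem IsEquivariant.exists_slash_mul_eq_smul [Nontrivial n] (hX : IsEquivariant ρ X)
    (q : n → ℝ) :
    ∃ g, ∃ r : ℝ, 1 < r ∧ slash X q * ρ g = (r : ℂ) • (ρ g * slash X q) := by
  obtain ⟨g, r, hr, hg⟩ := exists_smul_eq_smul q
  refine ⟨g⁻¹, r, hr, ?_⟩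
  rw [Complex.coe_smul, ← mul_smul_comm, ← map_smul, ← hg, hX, inv_smul_smul]

theorem neg_one_mul_slash [Fact (Even (Fintype.card n))]
    (hX : IsEquivariant ρ X ∨ IsEquivariant (ρ.comp inverseTranspose) X) (q : n → ℝ) :
    ρ (-1) * slash X q = -(slash X q * ρ (-1)) := by
  rcases hX with hX | hX
  · exact hX.neg_one_mul_slash q
  · simpa only [MonoidHom.comp_apply, inverseTranspose_neg_one] using hX.neg_one_mul_slash q

theorem exists_slash_mul_eq_smul [Nontrivial n]
    (hX : IsEquivariant ρ X ∨ IsEquivariant (ρ.comp inverseTranspose) X) (q : n → ℝ) :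
    ∃ g, ∃ r : ℝ, 1 < r ∧ slash X q * ρ g = (r : ℂ) • (ρ g * slash X q) := by
  rcases hX with hX | hX
  · exact hX.exists_slash_mul_eq_smul q
  · obtain ⟨g, r, hr, h⟩ := hX.exists_slash_mul_eq_smul q
    exact ⟨inverseTranspose g, r, hr, h⟩

theorem block_slash_eq_zero {ι : Type*} [DecidableEq ι] {ρ : Representation ℂ SL(4, ℝ) V}
    {X : Fin 4 → Module.End ℂ V} {U : ι → Subrepresentation ρ}
    (hU : DirectSum.IsInternal fun i => (U i).toSubmodule)
    (hirr : ∀ i, (U i).toRepresentation.IsIrreducible)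
    (hX : IsEquivariant ρ X ∨ IsEquivariant (ρ.comp inverseTranspose) X) (q : Fin 4 → ℝ)
    {i j : ι} (hij : Nonempty ((U i).toRepresentation.Equiv (U j).toRepresentation) ∨
      Nonempty ((U i).toRepresentation.Equiv (U j).toRepresentation.dual)) :
    block hU (slash X q) i j = 0 :=
  block_eq_zero_of_equiv_or_dual hU hirr (neg_one_mul_slash hX q) hij

end Equivariance

theorem map_zero_of_map_add {M G : Type*} [AddMonoid M] [Group G] {γ : M → G}
    (hadd : ∀ s t, γ (s + t) = γ s * γ t) : γ 0 = 1 := by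
  have h := hadd 0 0
  rwa [add_zero, left_eq_mul] at h

section VectorOperators

open Matrix.SpecialLinearGroup

variable {V : Type*} [NormedAddCommGroup V] [NormedSpace ℂ V]
  {ρ : Representation ℂ SL(4, ℝ) V} {X : Fin 4 → Module.End ℂ V}

theorem IsVectorOperator.commutator_slash (hX : IsVectorOperator ρ X)
    {A : Matrix (Fin 4) (Fin 4) ℝ} {B : Module.End ℂ V} (hB : IsGenerator ρ A B)
    (q : Fin 4 → ℝ) : B * slash X q - slash X q * B = slash X (A.mulVec q) := by
  calc B * slash X q - slash X q * B = ∑ α, (q α : ℂ) • (B * X α - X α * B) := by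
        simp only [slash_eq_sum, Finset.mul_sum, Finset.sum_mul, mul_smul_comm, smul_mul_assoc,
          ← Finset.sum_sub_distrib, ← smul_sub]
    _ = ∑ α, ∑ β, ((A β α * q α : ℝ) : ℂ) • X β := by
        simp only [hX A B hB, Finset.smul_sum, smul_smul, Complex.ofReal_mul, mul_comm]
    _ = slash X (A.mulVec q) := by
        rw [Finset.sum_comm]
        simp only [slash_eq_sum, Matrix.mulVec, dotProduct, Complex.ofReal_sum, Finset.sum_smul]

variable [FiniteDimensional ℂ V]

theorem exists_isGenerator (hρ : IsContinuousRep ρ) {γ : ℝ → SL(4, ℝ)} (hγ : Continuous γ)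
    (hadd : ∀ s t, γ (s + t) = γ s * γ t) {A : Matrix (Fin 4) (Fin 4) ℝ}
    (hA : ∀ i j, HasDerivAt (fun t => (γ t).1 i j) (A i j) 0) :
    ∃ B, IsGenerator ρ A B ∧
      HasDerivAt (fun t => Module.End.toContinuousLinearMap V (ρ (γ t)))
        (Module.End.toContinuousLinearMap V B) 0 := by
  have := FiniteDimensional.complete ℂ V
  have hcont : Continuous fun t => Module.End.toContinuousLinearMap V (ρ (γ t)) :=
    continuous_clm_apply.2 fun v => (hρ v).comp hγ
  obtain ⟨B, hB⟩ := exists_hasDerivAt_of_continuous hcont (by simp [map_zero_of_map_add hadd])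
    (fun s t => by rw [hadd, map_mul, map_mul])
  refine ⟨B.toLinearMap, ⟨γ, hadd, hA, fun v => ?_⟩, hB⟩
  exact ((ContinuousLinearMap.apply ℂ V v).restrictScalars ℝ).hasFDerivAt.comp_hasDerivAt 0 hB

theorem IsVectorOperator.rep_mul_slash (hρ : IsContinuousRep ρ) (hX : IsVectorOperator ρ X)
    {γ : ℝ → SL(4, ℝ)} (hγ : Continuous γ) (hadd : ∀ s t, γ (s + t) = γ s * γ t)
    {A : Matrix (Fin 4) (Fin 4) ℝ} (hA : ∀ i j, HasDerivAt (fun t => (γ t).1 i j) (A i j) 0)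
    (hsq : A * A = 0) (t : ℝ) (q : Fin 4 → ℝ) :
    ρ (γ t) * slash X q = slash X (q + t • A.mulVec q) * ρ (γ t) := by
  obtain ⟨B, hgen, hB⟩ := exists_isGenerator hρ hγ hadd hA
  let Φ : Module.End ℂ V ≃ₐ[ℂ] (V →L[ℂ] V) := Module.End.toContinuousLinearMap V
  have hcomm : B * slash X q - slash X q * B = slash X (A.mulVec q) := hX.commutator_slash hgen q
  have hcomm' : Commute B (slash X (A.mulVec q)) := by
    have h := hX.commutator_slash hgen (A.mulVec q)
    rwa [Matrix.mulVec_mulVec, hsq, Matrix.zero_mulVec, map_zero, sub_eq_zero] at h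
  have hadd' (s t : ℝ) : Φ (ρ (γ (s + t))) = Φ (ρ (γ s)) * Φ (ρ (γ t)) := by
    rw [hadd, map_mul, map_mul]
  have h0 : Φ (ρ (γ 0)) = 1 := by rw [map_zero_of_map_add hadd, map_one, map_one]
  have h := mul_eq_add_smul_mul_of_commutator h0 (hasDerivAt_of_hasDerivAt_zero hadd' hB)
    (X := Φ (slash X q)) (N := Φ (slash X (A.mulVec q)))
    (by rw [← map_mul, ← map_mul, ← map_sub, hcomm]) (hcomm'.map Φ) t
  apply Φ.injective
  rw [map_mul, h, map_add, map_smul, map_mul, map_add]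
  rfl

theorem IsVectorOperator.isEquivariant (hρ : IsContinuousRep ρ) (hX : IsVectorOperator ρ X) :
    IsEquivariant ρ X := by
  refine isEquivariant_of_transvection fun i j hij a q => ?_
  have hcoe (t : ℝ) : (transvection hij t).1 = 1 + t • Matrix.single i j (1 : ℝ) := by
    rw [Matrix.smul_single, smul_eq_mul, mul_one]
    rfl
  have hγ : Continuous fun t : ℝ => transvection hij t := by
    have h : Continuous fun t : ℝ => 1 + t • Matrix.single i j (1 : ℝ) := by fun_prop
    exact continuous_induced_rng.2 (h.congr fun t => (hcoe t).symm)
  have hA (k l : Fin 4) : HasDerivAt (fun t => (transvection hij t).1 k l)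
      (Matrix.single i j (1 : ℝ) k l) 0 := by
    simp only [hcoe, Matrix.add_apply, Matrix.smul_apply, smul_eq_mul]
    exact (((hasDerivAt_id 0).mul_const _).const_add _).congr_deriv (one_mul _)
  have hq : transvection hij a • q = q + a • (Matrix.single i j (1 : ℝ)).mulVec q :=
    calc transvection hij a • q = (transvection hij a).1.mulVec q := rfl
      _ = _ := by rw [hcoe, Matrix.add_mulVec, Matrix.one_mulVec, Matrix.smul_mulVec]
  rw [hq]
  exact hX.rep_mul_slash hρ hγ (transvection_add hij) hA
    (Matrix.single_mul_single_of_ne _ _ _ _ hij.symm _) a q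

end VectorOperators

section UpperIndices

variable {V : Type*} [NormedAddCommGroup V] [NormedSpace ℂ V]
  {ρ : Representation ℂ SL(4, ℝ) V} {X : Fin 4 → Module.End ℂ V}

theorem IsContinuousRep.comp_inverseTranspose (hρ : IsContinuousRep ρ) :
    IsContinuousRep (ρ.comp inverseTranspose) := by
  have h : Continuous (inverseTranspose : SL(4, ℝ) → SL(4, ℝ)) :=
    continuous_induced_rng.2
      (continuous_subtype_val.comp (continuous_inv (G := SL(4, ℝ)))).matrix_transpose
  exact fun v => (hρ v).comp h

theorem IsGenerator.of_comp_inverseTranspose {A : Matrix (Fin 4) (Fin 4) ℝ} {B : Module.End ℂ V}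
    (hB : IsGenerator (ρ.comp inverseTranspose) A B) : IsGenerator ρ (-A.transpose) B := by
  obtain ⟨γ, hadd, hA, hB⟩ := hB
  have hinv (t : ℝ) : (γ t)⁻¹ = γ (-t) := by
    refine inv_eq_of_mul_eq_one_right ?_
    rw [← hadd, add_neg_cancel, map_zero_of_map_add hadd]
  refine ⟨fun t => inverseTranspose (γ t), fun s t => ?_, fun i j => ?_, hB⟩
  · simp only [hadd, map_mul]
  simp only [coe_inverseTranspose, hinv, Matrix.transpose_apply]
  have hji : HasDerivAt (fun t => (γ t).1 j i) (A j i) (-0) := by simpa using hA j i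
  exact (hji.comp 0 (hasDerivAt_neg 0)).congr_deriv (mul_neg_one _)

theorem IsContravariantVectorOperator.isVectorOperator (hX : IsContravariantVectorOperator ρ X) :
    IsVectorOperator (ρ.comp inverseTranspose) X := fun A B hB α => by
  rw [hX _ B hB.of_comp_inverseTranspose]
  simp

theorem isEquivariant_or_isEquivariant_comp_inverseTranspose [FiniteDimensional ℂ V]
    (hρ : IsContinuousRep ρ) (hX : IsVectorOperator ρ X ∨ IsContravariantVectorOperator ρ X) :
    IsEquivariant ρ X ∨ IsEquivariant (ρ.comp inverseTranspose) X :=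
  hX.imp (·.isEquivariant hρ) (·.isVectorOperator.isEquivariant hρ.comp_inverseTranspose)

end UpperIndices

section Dirac

variable {V : Type*} [NormedAddCommGroup V] [NormedSpace ℂ V] {ρ : Representation ℂ SL(4, ℝ) V}
  {X : Fin 4 → Module.End ℂ V} {κ : Module.End ℂ V}

theorem diracOp_of_hasFDerivAt {Ψ : (Fin 4 → ℝ) → V} {Ψ' : (Fin 4 → ℝ) →L[ℝ] V}
    {x : Fin 4 → ℝ} (h : HasFDerivAt Ψ Ψ' x) :
    diracOp X κ Ψ x = Complex.I • ∑ α, X α (Ψ' (Pi.single α 1)) - κ (Ψ x) := by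
  rw [diracOp, h.fderiv]

theorem hasFDerivAt_dotProduct {n : Type*} [Fintype n] (q x : n → ℝ) :
    HasFDerivAt (fun y => q ⬝ᵥ y) (LinearMap.toContinuousLinearMap (dotProductBilin ℝ ℝ q)) x :=
  (LinearMap.toContinuousLinearMap (dotProductBilin ℝ ℝ q)).hasFDerivAt

theorem diracOp_dotProduct_smul (q : Fin 4 → ℝ) (v : V) :
    diracOp X κ (fun x => (q ⬝ᵥ x) • v) 0 = Complex.I • slash X q v := by
  rw [diracOp_of_hasFDerivAt ((hasFDerivAt_dotProduct q 0).smul_const v)]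
  simp [slash_eq_sum]

theorem affineAct_dotProduct_smul (g : SL(4, ℝ)) (q : Fin 4 → ℝ) (v : V) :
    affineAct ρ (inverseTranspose g) 0 (fun x => (q ⬝ᵥ x) • v) =
      fun x => ((g • q) ⬝ᵥ x) • ρ (inverseTranspose g) v := by
  ext x
  have hdot : q ⬝ᵥ ((inverseTranspose g)⁻¹).1.mulVec x = (g • q) ⬝ᵥ x := by
    rw [← map_inv, coe_inverseTranspose, inv_inv, Matrix.mulVec_transpose, dotProduct_comm,
      ← Matrix.dotProduct_mulVec, dotProduct_comm]
    rfl
  simp only [affineAct, sub_zero, hdot, LinearMap.map_smul_of_tower]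

theorem IsAffineInvariant.isEquivariant (h : IsAffineInvariant ρ X κ) :
    IsEquivariant (ρ.comp inverseTranspose) X := by
  intro g q
  ext v
  -- At the origin a linear field is not seen by `κ`, and its derivative isolates `slash X q`.
  have hsmooth : ContDiff ℝ ∞ fun x => (q ⬝ᵥ x) • v :=
    ((LinearMap.toContinuousLinearMap (dotProductBilin ℝ ℝ q)).smulRight v).contDiff
  have hinv := congrFun (h (inverseTranspose g) 0 _ hsmooth) 0
  rw [affineAct_dotProduct_smul, diracOp_dotProduct_smul, affineAct, sub_zero, Matrix.mulVec_zero,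
    diracOp_dotProduct_smul, (ρ _).map_smul] at hinv
  exact (smul_right_injective V Complex.I_ne_zero hinv).symm

theorem diracOp_planeWave (p : Fin 4 → ℝ) (v : V) :
    diracOp X κ (fun y => Complex.exp (-Complex.I * ((∑ α, p α * y α : ℝ) : ℂ)) • v) 0 =
      slash X p v - κ v := by
  have hphase := ((Complex.ofRealCLM.hasFDerivAt.comp 0 (hasFDerivAt_dotProduct p 0)).const_mul
    (-Complex.I)).cexp.smul_const v
  refine (diracOp_of_hasFDerivAt hphase).trans ?_
  simp [slash_eq_sum, Finset.smul_sum, smul_smul, ← mul_assoc]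

end Dirac

section Solutions

theorem fderiv_apply_mem_of_forall_mem {E F : Type*} [NormedAddCommGroup E] [NormedSpace ℝ E]
    [NormedAddCommGroup F] [NormedSpace ℝ F] {K : Submodule ℝ F} (hK : IsClosed (K : Set F))
    {φ : E → F} {x : E} (hφ : DifferentiableAt ℝ φ x) (hφK : ∀ y, φ y ∈ K) (w : E) :
    fderiv ℝ φ x w ∈ K := by
  have hslope := hasDerivAt_iff_tendsto_slope_zero.1 (hφ.hasFDerivAt.hasLineDerivAt w)
  exact hK.mem_of_tendsto hslope
    (Filter.Eventually.of_forall fun t => K.smul_mem _ (K.sub_mem (hφK _) (hφK _)))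

variable {V ι : Type*} [NormedAddCommGroup V] [NormedSpace ℂ V] [FiniteDimensional ℂ V]
  [DecidableEq ι]

theorem eq_zero_of_component_diracOp_eq_zero {U : ι → Submodule ℂ V} (hU : DirectSum.IsInternal U)
    {X : Fin 4 → Module.End ℂ V} {κ : Module.End ℂ V} {i : ι} (hX : ∀ α, block hU (X α) i i = 0)
    {μ : ℂ} (hκ : ∀ v ∈ U i, κ v = μ • v)
    (h : ∃ φ : (Fin 4 → ℝ) → V, Differentiable ℝ φ ∧ (∀ x, φ x ∈ U i) ∧ φ ≠ 0 ∧
      ∀ x, component hU i (diracOp X κ φ x) = 0) : μ = 0 := by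
  obtain ⟨φ, hφ, hφU, hφ0, h⟩ := h
  obtain ⟨x, hx⟩ := Function.ne_iff.1 hφ0
  have hmem (w : Fin 4 → ℝ) : fderiv ℝ φ x w ∈ U i :=
    fderiv_apply_mem_of_forall_mem (K := (U i).restrictScalars ℝ)
      (U i).closed_of_finiteDimensional (hφ x) hφU w
  have hderiv (α : Fin 4) : component hU i (X α (fderiv ℝ φ x (Pi.single α 1))) = 0 :=
    LinearMap.congr_fun (hX α) ⟨_, hmem _⟩
  have hmass : μ • (⟨φ x, hφU x⟩ : U i) = 0 := by
    simpa [diracOp, hderiv, hκ _ (hφU x), component_of_mem hU (hφU x)] using h x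
  exact (smul_eq_zero.1 hmass).resolve_right fun h0 => hx (congrArg Subtype.val h0)

variable {ρ : Representation ℂ SL(4, ℝ) V} {X : Fin 4 → Module.End ℂ V} {κ : Module.End ℂ V}

theorem exists_isEquivariant_slash_eq (hρ : IsContinuousRep ρ)
    (h : IsAffineInvariant ρ X κ ∨
      ∃ (Y : Fin 4 → Module.End ℂ V) (c : Matrix (Fin 4) (Fin 4) ℝ),
        (IsVectorOperator ρ Y ∨ IsContravariantVectorOperator ρ Y) ∧
        ∀ α, X α = ∑ β, (c α β : ℂ) • Y β) :
    ∃ Y : Fin 4 → Module.End ℂ V,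
      (IsEquivariant ρ Y ∨ IsEquivariant (ρ.comp inverseTranspose) Y) ∧
      ∀ p, ∃ q, slash X p = slash Y q := by
  rcases h with h | ⟨Y, c, hY, hXY⟩
  · exact ⟨X, Or.inr h.isEquivariant, fun p => ⟨p, rfl⟩⟩
  · refine ⟨Y, isEquivariant_or_isEquivariant_comp_inverseTranspose hρ hY,
      fun p => ⟨∑ α, p α • c α, ?_⟩⟩
    calc slash X p = ∑ α, (p α : ℂ) • slash Y (c α) := by simp only [slash_eq_sum, hXY]
      _ = slash Y (∑ α, p α • c α) := by simp only [map_sum, map_smul, Complex.coe_smul]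

theorem exists_mass_eq_zero_of_slash_apply_eq {U : ι → Subrepresentation ρ}
    (hU : DirectSum.IsInternal fun i => (U i).toSubmodule)
    (hX : IsEquivariant ρ X ∨ IsEquivariant (ρ.comp inverseTranspose) X) {m : ι → ℂ}
    (hκ : ∀ i, ∀ v ∈ U i, κ v = m i • v) {q : Fin 4 → ℝ} {v : V} (hv : v ≠ 0)
    (h : slash X q v = κ v) : ∃ i, m i = 0 := by
  by_contra! hm
  obtain ⟨g, r, hr, hg⟩ := exists_slash_mul_eq_smul hX q
  have hpow : Function.Injective fun n : ℕ => (r : ℂ) ^ n := by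
    have h := Complex.ofReal_injective.comp (pow_right_strictMono₀ hr).injective
    simpa only [Function.comp_def, Complex.ofReal_pow] using h
  have hinj : Function.Injective (ρ g) := (ρ.apply_bijective g).injective
  exact hv (eq_zero_of_rescaling hpow hinj hg
    (commute_of_scalar hU hκ fun i v hv => (U i).apply_mem_toSubmodule g hv)
    (injective_of_scalar_ne_zero hU hκ hm) h)

end Solutions

end SL4

theorem mainTheorem3 {V W ι : Type*}
    [NormedAddCommGroup V] [NormedSpace ℂ V] [FiniteDimensional ℂ V]
    [AddCommGroup W] [Module ℂ W] [FiniteDimensional ℂ W] [DecidableEq ι]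
    (ρ : Representation ℂ SL(4, ℝ) V) (hρ : SL4.IsContinuousRep ρ)
    (σ : Representation ℂ SL(4, ℝ) W) :
    -- the vector representation is the one with label `[1, 0, 0]`
    SL4.HasLabel SL4.vectorRep 1 0 0 ∧
    -- for irreducible `D`, `D ⊗ [1, 0, 0]` contains neither `D` nor its contragredient
    (ρ.IsIrreducible →
      ¬ SL4.Contains (ρ.tprod SL4.vectorRep) ρ ∧
      ¬ SL4.Contains (ρ.tprod SL4.vectorRep) ρ.dual) ∧
    -- the same in terms of labels
    (∀ l₁ l₂ l₃ : ℤ, SL4.HasLabel ρ l₁ l₂ l₃ →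
      (SL4.HasLabel σ l₁ l₂ l₃ ∨ SL4.HasLabel σ l₁ (l₁ - l₃) (l₁ - l₂)) →
      ¬ SL4.Contains (ρ.tprod SL4.vectorRep) σ) ∧
    -- decompositions into irreducible representations
    (∀ (U : ι → Subrepresentation ρ)
      (hU : DirectSum.IsInternal fun i => (U i).toSubmodule),
      (∀ i, (U i).toRepresentation.IsIrreducible) →
      -- the diagonal blocks of a vector operator vanish, and so do the blocks between
      -- equivalent or mutually contragredient components
      (∀ X : Fin 4 → Module.End ℂ V,
        (SL4.IsVectorOperator ρ X ∨ SL4.IsContravariantVectorOperator ρ X) →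
        (∀ α i, SL4.block hU (X α) i i = 0) ∧
        (∀ α i j,
          (Nonempty ((U i).toRepresentation.Equiv (U j).toRepresentation) ∨
            Nonempty ((U i).toRepresentation.Equiv (U j).toRepresentation.dual)) →
          SL4.block hU (X α) i j = 0)) ∧
      -- Dirac-type equations `i X^α ∂_α Ψ = κ Ψ` with diagonal mass operator `κ`
      (∀ (X : Fin 4 → Module.End ℂ V) (κ : Module.End ℂ V) (m : ι → ℂ),
        (SL4.IsAffineInvariant ρ X κ ∨
          ∃ (Y : Fin 4 → Module.End ℂ V) (c : Matrix (Fin 4) (Fin 4) ℝ),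
            (SL4.IsVectorOperator ρ Y ∨ SL4.IsContravariantVectorOperator ρ Y) ∧
            ∀ α, X α = ∑ β, (c α β : ℂ) • Y β) →
        (∀ i, ∀ v ∈ U i, κ v = m i • v) →
        -- a nonzero solution of the equation restricted to a component forces its mass to vanish
        (∀ i, (∃ φ : (Fin 4 → ℝ) → V, Differentiable ℝ φ ∧ (∀ x, φ x ∈ U i) ∧ φ ≠ 0 ∧
            ∀ x, SL4.component hU i (SL4.diracOp X κ φ x) = 0) → m i = 0) ∧
        -- hence `κ = 0` if every component carries such a solution
        ((∀ i, ∃ φ : (Fin 4 → ℝ) → V, Differentiable ℝ φ ∧ (∀ x, φ x ∈ U i) ∧ φ ≠ 0 ∧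
            ∀ x, SL4.component hU i (SL4.diracOp X κ φ x) = 0) → κ = 0) ∧
        -- a nonzero plane wave solution of the full equation excludes that all masses are
        -- nonzero, and forces `κ = 0` if all masses are equal
        (∀ (p : Fin 4 → ℝ) (v : V), v ≠ 0 →
          (∀ x, SL4.diracOp X κ
            (fun y => Complex.exp (-Complex.I * ((∑ α, p α * y α : ℝ) : ℂ)) • v) x = 0) →
          (∃ i, m i = 0) ∧ ((∀ i j, m i = m j) → κ = 0)))) := by
  refine ⟨SL4.hasLabel_vectorRep, fun h => ⟨SL4.not_contains_self h, SL4.not_contains_dual h⟩,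
    fun l₁ l₂ l₃ => SL4.not_contains_of_hasLabel, fun U hU hirr => ⟨fun X hX => ?_,
      fun X κ m hX hκ => ?_⟩⟩
  · have hequiv := SL4.isEquivariant_or_isEquivariant_comp_inverseTranspose hρ hX
    simp only [← SL4.slash_single X]
    exact ⟨fun α i => SL4.block_slash_eq_zero hU hirr hequiv _ (Or.inl ⟨.refl _⟩),
      fun α i j => SL4.block_slash_eq_zero hU hirr hequiv _⟩
  · obtain ⟨Y, hY, hXY⟩ := SL4.exists_isEquivariant_slash_eq hρ hX
    have hblock (α : Fin 4) (i : ι) : SL4.block hU (X α) i i = 0 := by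
      obtain ⟨q, hq⟩ := hXY (Pi.single α 1)
      rw [← SL4.slash_single X, hq]
      exact SL4.block_slash_eq_zero hU hirr hY q (Or.inl ⟨.refl _⟩)
    have hmass (i : ι) :=
      SL4.eq_zero_of_component_diracOp_eq_zero hU (hblock · i) (hκ i)
    refine ⟨hmass, fun h => SL4.eq_zero_of_scalar_eq_zero hU hκ fun i => hmass i (h i),
      fun p v hv h => ?_⟩
    obtain ⟨q, hq⟩ := hXY p
    have hqv : SL4.slash Y q v = κ v := by rw [← hq, ← sub_eq_zero, ← SL4.diracOp_planeWave, h]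
    obtain ⟨i, hi⟩ := SL4.exists_mass_eq_zero_of_slash_apply_eq hU hY hκ hv hqv
    exact ⟨⟨i, hi⟩, fun hm => SL4.eq_zero_of_scalar_eq_zero hU hκ fun j => (hm j i).trans hi⟩
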